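/- Let $X$ be a connected Riemannian manifold (possibly with boundary or corners) of dimension $D\ge 1$, with Riemannian distance $d$ and Riemannian volume $m$, and let $\mu$ be a Borel probability measure on $X$ with a density $h=\frac{d\mu}{dm}$. Let $T:X\to X$ be an ergodic $\mu$-preserving map. Assume: (A) there are constants $C$ and $0<\theta<1$ such that for all bounded Lipschitz functions $\varphi,\psi:X\to\mathbb R$ and all integers $j\ge 0$, $$\Big|\int \varphi\cdot\psi\circ T^j\,d\mu-\int\varphi\,d\mu\int\psi\,d\mu\Big|\le C\theta^j\|\varphi\|_{\mathrm{Lip}}\|\psi\|_{\mathrm{Lip}},$$ where $\|\varphi\|_{\mathrm{Lip}}=\sup|\varphi|+\mathrm{Lip}(\varphi)$; (B) there are $r_0>0$ and $0<\delta<1$ such that $\mu\{x: r<d(x,q)<r+\varepsilon\}<\varepsilon^\delta$ for all $q\in X$ and all $0<\varepsilon<r\le r_0$. Let $p\in X$ be a point at which the density $h$ lies between two positive constants, in the sense that for some $0<C_1\le C_2<\infty$ and all sufficiently small $r>0$ the average of $h$ with respect to $m$ over the ball of radius $r$ about $p$ lies in $[C_1,C_2]$. For $k\in\mathbb R$ let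 $\phi(x)=d(x,p)^{-k}$ (with $\phi(p)=\infty$ if $k>0$) and $S_n=\sum_{j=0}^{n-1}\phi\circ T^j$. If $k>D$, then for every $\epsilon>0$, for $\mu$-a.e. $x$, $$\limsup_{n\to\infty}\frac{S_n(x)}{n^{k/D}(\log n)^{k/D+\epsilon}}=0\qquad\text{and}\qquad \liminf_{n\to\infty}\frac{S_n(x)}{n^{k/D}\big(e^{-(\log n)^{1/2+\epsilon}}\big)^{k/D}}>1 .$$ If $k=D$, then there is a constant $a>0$ such that $\liminf_{n\to\infty}\frac{S_n(x)}{n}>a$ for $\mu$-a.e. $x$. -/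

import Mathlib

open MeasureTheory Filter Topology Bundle
open scoped ENNReal NNReal Manifold

noncomputable section

/-- The Lipschitz norm `‖f‖_Lip = sup |f| + Lip(f)` of a bounded Lipschitz function `f`, where
`Lip(f)` is the smallest Lipschitz constant of `f`. It is only used for functions that are bounded
and Lipschitz. -/
def lipNorm {X : Type*} [MetricSpace X] (f : X → ℝ) : ℝ :=
  (⨆ x, |f x|) + sInf {K : ℝ | 0 ≤ K ∧ ∀ x y, |f x - f y| ≤ K * dist x y}

/-- Functions of finite Lipschitz norm: bounded Lipschitz functions. -/
def IsBddLipschitz {X : Type*} [MetricSpace X] (f : X → ℝ) : Prop :=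
  (∃ K : ℝ≥0, LipschitzWith K f) ∧ ∃ M : ℝ, ∀ x, |f x| ≤ M

/-- Condition (A), exponential decay of correlations for Lipschitz functions:
`|E(φ · ψ ∘ T^j) - E(φ) E(ψ)| ≤ C θ^j ‖φ‖_Lip ‖ψ‖_Lip`. -/
def ExpDecayLipschitz {X : Type*} [MetricSpace X] [MeasurableSpace X]
    (T : X → X) (μ : Measure X) : Prop :=
  ∃ C θ : ℝ, 0 < θ ∧ θ < 1 ∧
    ∀ φ ψ : X → ℝ, IsBddLipschitz φ → IsBddLipschitz ψ → ∀ j : ℕ,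
      |(∫ x, φ x * ψ (T^[j] x) ∂μ) - (∫ x, φ x ∂μ) * ∫ x, ψ x ∂μ|
        ≤ C * θ ^ j * lipNorm φ * lipNorm ψ

/-- Condition (B), the measure of thin annuli: `μ {x | r < d(x,q) < r + ε} < ε^δ` for all points
`q` and all `0 < ε < r ≤ r₀`. -/
def ThinAnnuli {X : Type*} [MetricSpace X] [MeasurableSpace X] (μ : Measure X) : Prop :=
  ∃ r₀ δ : ℝ, 0 < r₀ ∧ 0 < δ ∧ δ < 1 ∧
    ∀ q : X, ∀ ε r : ℝ, 0 < ε → ε < r → r ≤ r₀ →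
      μ {x | r < dist x q ∧ dist x q < r + ε} < ENNReal.ofReal (ε ^ δ)

/-- The density `h` with respect to `m` lies at the point `p` between two positive constants.
As `h` is only determined almost everywhere, its value at `p` is read through its averages over
small balls about `p`. This holds in particular if `h` is a.e. between two positive constants on a
neighbourhood of `p`, or if `h` is continuous at `p` with `0 < h p < ∞`. -/
def DensityBoundedAt {X : Type*} [MetricSpace X] [MeasurableSpace X]
    (m : Measure X) (h : X → ℝ≥0∞) (p : X) : Prop :=
  ∃ C₁ C₂ : ℝ, 0 < C₁ ∧ ∀ᶠ r : ℝ in 𝓝[>] 0,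
    ENNReal.ofReal C₁ ≤ (⨍⁻ x in Metric.ball p r, h x ∂m) ∧
      (⨍⁻ x in Metric.ball p r, h x ∂m) ≤ ENNReal.ofReal C₂

/-- The observable `φ(x) = d(x,p)^{-k}`, with `φ(p) = ∞` for `k > 0`. -/
def poleObservable {X : Type*} [MetricSpace X] (p : X) (k : ℝ) (x : X) : ℝ≥0∞ :=
  edist x p ^ (-k)

/-- The Birkhoff sum `S_n = ∑_{j=0}^{n-1} φ ∘ T^j`. -/
def birkhoffS {X : Type*} (T : X → X) (φ : X → ℝ≥0∞) (n : ℕ) (x : X) : ℝ≥0∞ :=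
  ∑ j ∈ Finset.range n, φ (T^[j] x)

end

section Geometry

open Set Metric Manifold

attribute [local instance] normedAddCommGroupTangentSpaceVectorSpace
attribute [local instance] normedSpaceTangentSpaceVectorSpace

variable {E : Type*} [NormedAddCommGroup E] [NormedSpace ℝ E]
  {H : Type*} [TopologicalSpace H] (I : ModelWithCorners ℝ E H)
  {X : Type*} [MetricSpace X] [ChartedSpace H X] [IsManifold I 1 X]
  [RiemannianBundle (fun x : X => TangentSpace I x)]
  [IsContinuousRiemannianBundle E (fun x : X => TangentSpace I x)]

lemma exists_eventually_enorm_mfderivWithin_symm_le (p : X) :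
    ∃ C : ℝ≥0, 0 < C ∧ ∀ᶠ y in 𝓝[range I] (extChartAt I p p),
      ∀ v : TangentSpace 𝓘(ℝ, E) y, ‖mfderiv[range I] (extChartAt I p).symm y v‖ₑ ≤ C * ‖v‖ₑ := by
  rcases eventually_enorm_mfderivWithin_symm_extChartAt_lt I p with ⟨C, C_pos, hC⟩
  refine ⟨C, C_pos, ?_⟩
  filter_upwards [hC] with y hy v
  have h1 := ContinuousLinearMap.le_opENorm (mfderiv[range I] (extChartAt I p).symm y) v
  exact h1.trans (mul_le_mul_left hy.le _)

lemma exists_eventually_enorm_mfderiv_le (p : X) :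
    ∃ C : ℝ≥0, 0 < C ∧ ∀ᶠ y in 𝓝 p,
      ∀ v : TangentSpace I y, ‖mfderiv% (extChartAt I p) y v‖ₑ ≤ C * ‖v‖ₑ := by
  rcases eventually_enorm_mfderiv_extChartAt_lt I p with ⟨C, C_pos, hC⟩
  refine ⟨C, C_pos, ?_⟩
  filter_upwards [hC] with y hy v
  have h1 := ContinuousLinearMap.le_opENorm (mfderiv% (extChartAt I p) y) v
  exact h1.trans (mul_le_mul_left hy.le _)

variable [IsRiemannianManifold I X]

/-- The inverse of an extended chart is Lipschitz near the centre of the chart. -/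
lemma exists_lipschitzOnWith_extChartAt_symm (p : X) :
    ∃ C : ℝ≥0, 0 < C ∧ ∃ r > 0, ball (extChartAt I p p) r ∩ range I ⊆ (extChartAt I p).target ∧
      LipschitzOnWith C (extChartAt I p).symm (ball (extChartAt I p p) r ∩ range I) := by
  rcases exists_eventually_enorm_mfderivWithin_symm_le I p with ⟨C, C_pos, hC⟩
  obtain ⟨r, r_pos, hr⟩ : ∃ r > 0,
      ball (extChartAt I p p) r ∩ range I ⊆ (extChartAt I p).target ∩
        {y | ∀ v : TangentSpace 𝓘(ℝ, E) y, ‖mfderiv[range I] (extChartAt I p).symm y v‖ₑ ≤ C * ‖v‖ₑ} :=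
    mem_nhdsWithin_iff.1 (inter_mem (extChartAt_target_mem_nhdsWithin p) hC)
  refine ⟨C, C_pos, r, r_pos, hr.trans inter_subset_left, ?_⟩
  intro u hu v hv
  rw [IsRiemannianManifold.out (I := I)]
  let η := ContinuousAffineMap.lineMap (R := ℝ) u v
  set γ := (extChartAt I p).symm ∘ η
  have hη : Icc 0 1 ⊆ ⇑η ⁻¹' ((extChartAt I p).target ∩
        {y | ∀ v : TangentSpace 𝓘(ℝ, E) y, ‖mfderiv[range I] (extChartAt I p).symm y v‖ₑ ≤ C * ‖v‖ₑ}) := by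
    simp only [← image_subset_iff, ContinuousAffineMap.coe_lineMap_eq,
     ← segment_eq_image_lineMap, η]
    apply Subset.trans _ hr
    exact ((convex_ball _ _).inter I.convex_range).segment_subset hu hv
  simp only [preimage_inter, subset_inter_iff] at hη
  have η_smooth : CMDiff[Icc 0 1] 1 η := by
    apply ContMDiff.contMDiffOn
    rw [contMDiff_iff_contDiff]
    exact ContinuousAffineMap.contDiff _
  have : riemannianEDist I ((extChartAt I p).symm u) ((extChartAt I p).symm v)
      ≤ pathELength I γ 0 1 := by
    apply riemannianEDist_le_pathELength _ _ _ zero_le_one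
    · exact (contMDiffOn_extChartAt_symm p).comp η_smooth hη.1
    · simp [γ, η, ContinuousAffineMap.coe_lineMap_eq]
    · simp [γ, η, ContinuousAffineMap.coe_lineMap_eq]
  apply this.trans
  rw [← lintegral_fderiv_lineMap_eq_edist, pathELength_eq_lintegral_mfderivWithin_Icc,
    ← lintegral_const_mul' _ _ ENNReal.coe_ne_top]
  apply setLIntegral_mono' measurableSet_Icc (fun t ht ↦ ?_)
  have : mfderiv[Icc 0 1] γ t =
      (mfderiv[range I] (extChartAt I p).symm (η t)) ∘L (mfderiv[Icc 0 1] η t) := by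
    apply mfderivWithin_comp
    · exact mdifferentiableWithinAt_extChartAt_symm (hη.1 ht)
    · exact η_smooth.mdifferentiableOn one_ne_zero t ht
    · exact hη.1.trans (preimage_mono (extChartAt_target_subset_range p))
    · rw [uniqueMDiffWithinAt_iff_uniqueDiffWithinAt]
      exact uniqueDiffOn_Icc zero_lt_one t ht
  have : mfderiv[Icc 0 1] γ t 1 =
      (mfderiv[range I] (extChartAt I p).symm (η t)) (mfderiv[Icc 0 1] η t 1) := congr($this 1)
  rw [this]
  refine (hη.2 ht _).trans (mul_le_mul_right ?_ _)
  simp only [mfderivWithin_eq_fderivWithin]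
  exact le_of_eq rfl

/-- An extended chart is Lipschitz near its centre. -/
lemma exists_lipschitzOnWith_extChartAt (p : X) :
    ∃ C : ℝ≥0, 0 < C ∧ ∃ r > 0, ball p r ⊆ (extChartAt I p).source ∧
      LipschitzOnWith C (extChartAt I p) (ball p r) := by
  rcases exists_eventually_enorm_mfderiv_le I p with ⟨C, C_pos, hC⟩
  obtain ⟨R, R_pos, hR⟩ := Metric.mem_nhds_iff.1
    (Filter.inter_mem hC (extChartAt_source_mem_nhds (I := I) p))
  rw [subset_inter_iff] at hR
  have hRs : ball p R ⊆ (chartAt H p).source := by simpa [extChartAt_source I p] using hR.2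
  refine ⟨C, C_pos, R / 3, by positivity, (ball_subset_ball (by linarith)).trans hR.2, ?_⟩
  intro x hx y hy
  have hxy : riemannianEDist I x y < ENNReal.ofReal (2 * R / 3) := by
    rw [← IsRiemannianManifold.out (I := I), edist_dist]
    refine (ENNReal.ofReal_lt_ofReal_iff (by positivity)).2 ?_
    have := dist_triangle_right x y p
    rw [mem_ball] at hx hy
    linarith
  rw [IsRiemannianManifold.out (I := I) x y]
  refine ENNReal.le_of_forall_pos_le_add fun ε ε_pos _ => ?_
  have hB : riemannianEDist I x y <
      min (ENNReal.ofReal (2 * R / 3)) (riemannianEDist I x y + ε / C) :=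
    lt_min hxy (ENNReal.lt_add_right hxy.ne_top
      (ENNReal.div_pos (by exact_mod_cast ε_pos.ne') ENNReal.coe_ne_top).ne')
  rcases exists_lt_locally_constant_of_riemannianEDist_lt hB zero_lt_one
    with ⟨γ, hγx, hγy, γ_smooth, hγ, -⟩
  rw [lt_min_iff] at hγ
  have hmem : ∀ t ∈ Icc (0 : ℝ) 1, γ t ∈ ball p R := by
    intro t ht
    have h1 : edist x (γ t) < ENNReal.ofReal (2 * R / 3) := by
      rw [IsRiemannianManifold.out (I := I)]
      calc riemannianEDist I x (γ t) ≤ pathELength I γ 0 t :=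
            riemannianEDist_le_pathELength γ_smooth.contMDiffOn hγx rfl ht.1
        _ ≤ pathELength I γ 0 1 := pathELength_mono le_rfl ht.2
        _ < _ := hγ.1
    rw [edist_dist, ENNReal.ofReal_lt_ofReal_iff (by positivity)] at h1
    have := dist_triangle_left (γ t) p x
    rw [mem_ball] at hx ⊢
    linarith
  let γ' := extChartAt I p ∘ γ
  have hC' : CMDiff[Icc 0 1] 1 γ' :=
    contMDiffOn_extChartAt.comp (I' := I) (t := (chartAt H p).source)
      γ_smooth.contMDiffOn (fun t' ht' ↦ hRs <| hmem t' ht')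
  calc edist (extChartAt I p x) (extChartAt I p y)
    _ = ‖γ' 1 - γ' 0‖ₑ := by
      rw [edist_comm, edist_eq_enorm_sub]; simp [γ', hγx, hγy]
    _ ≤ ∫⁻ t' in Icc 0 1, ‖derivWithin γ' (Icc 0 1) t'‖ₑ := by
      apply enorm_sub_le_lintegral_derivWithin_Icc_of_contDiffOn_Icc _ zero_le_one
      rwa [← contMDiffOn_iff_contDiffOn]
    _ = ∫⁻ t' in Icc 0 1, ‖mfderiv[Icc 0 1] γ' t' 1‖ₑ := by
      simp_rw [← fderivWithin_derivWithin, mfderivWithin_eq_fderivWithin]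
      rfl
    _ ≤ ∫⁻ t' in Icc 0 1, C * ‖mfderiv[Icc 0 1] γ t' 1‖ₑ := by
      apply setLIntegral_mono' measurableSet_Icc (fun t' ht' ↦ ?_)
      have : mfderiv[Icc 0 1] γ' t' =
          (mfderiv% (extChartAt I p) (γ t')) ∘L (mfderiv[Icc 0 1] γ t') := by
        apply mfderiv_comp_mfderivWithin
        · exact mdifferentiableAt_extChartAt (hRs (hmem t' ht'))
        · exact (γ_smooth.mdifferentiable one_ne_zero).mdifferentiableOn _ ht'
        · rw [uniqueMDiffWithinAt_iff_uniqueDiffWithinAt]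
          exact uniqueDiffOn_Icc zero_lt_one _ ht'
      have : mfderiv[Icc 0 1] γ' t' 1 =
          (mfderiv% (extChartAt I p) (γ t')) (mfderiv[Icc 0 1] γ t' 1) :=
        congr($this 1)
      rw [this]
      exact hR.1 (hmem t' ht') _
    _ = C * pathELength I γ 0 1 := by
      rw [lintegral_const_mul' _ _ ENNReal.coe_ne_top,
          pathELength_eq_lintegral_mfderivWithin_Icc]
    _ ≤ C * (riemannianEDist I x y + ε / C) := mul_le_mul_right hγ.2.le _
    _ = C * riemannianEDist I x y + ε := by
      rw [mul_add, ENNReal.mul_div_cancel (by exact_mod_cast C_pos.ne') ENNReal.coe_ne_top]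

end Geometry

section Volume

open Set Metric Manifold

lemma Convex.exists_pow_le_measure_ball_inter {E : Type*} [NormedAddCommGroup E] [NormedSpace ℝ E]
    [FiniteDimensional ℝ E] [MeasurableSpace E] [BorelSpace E] (ν : Measure E) [ν.IsAddHaarMeasure]
    {K : Set E} (hK : Convex ℝ K) (hKi : (interior K).Nonempty) {z : E} (hz : z ∈ K) :
    ∃ c > 0, ∀ ρ : ℝ, 0 < ρ → ρ ≤ 1 →
      ENNReal.ofReal (c * ρ ^ Module.finrank ℝ E) ≤ ν (ball z ρ ∩ K) := by
  obtain ⟨w, hw⟩ := hKi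
  obtain ⟨η, η_pos, hη⟩ := Metric.mem_nhds_iff.1 (mem_interior_iff_mem_nhds.1 hw)
  have hb : 0 < ν (ball 0 1) := measure_ball_pos _ _ one_pos
  have hb' : ν (ball 0 1) ≠ ∞ := measure_ball_lt_top.ne
  set R := dist w z + η + 1 with hR
  have R_pos : 0 < R := by positivity
  have R_ge : 1 ≤ R := by have := dist_nonneg (x := w) (y := z); linarith
  refine ⟨(η / R) ^ Module.finrank ℝ E * (ν (ball 0 1)).toReal,
    mul_pos (by positivity) (ENNReal.toReal_pos hb.ne' hb'), fun ρ ρ_pos hρ => ?_⟩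
  have ht : 0 < ρ / R := by positivity
  have ht1 : ρ / R ≤ 1 := (div_le_one R_pos).2 (hρ.trans R_ge)
  have hsub : ball (z + (ρ / R) • (w - z)) (ρ / R * η) ⊆ ball z ρ ∩ K := by
    intro v hv
    rw [mem_ball, dist_eq_norm] at hv
    set u := w + (ρ / R)⁻¹ • (v - (z + (ρ / R) • (w - z))) with hu
    have huη : u ∈ ball w η := by
      rw [mem_ball, dist_eq_norm, hu, add_sub_cancel_left, norm_smul, norm_inv,
        Real.norm_of_nonneg ht.le, inv_mul_lt_iff₀ ht]
      exact hv
    have hv' : v = z + (ρ / R) • (u - z) := by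
      rw [hu, add_sub_right_comm, smul_add, smul_smul, mul_inv_cancel₀ ht.ne', one_smul]
      abel
    refine ⟨?_, ?_⟩
    · rw [mem_ball, dist_eq_norm, hv', add_sub_cancel_left, norm_smul, Real.norm_of_nonneg ht.le,
        div_mul_eq_mul_div, div_lt_iff₀ R_pos]
      refine mul_lt_mul_of_pos_left ?_ ρ_pos
      have h1 := dist_triangle u w z
      rw [mem_ball] at huη
      rw [← dist_eq_norm]
      linarith
    · rw [hv']
      exact hK.add_smul_sub_mem hz (hη huη) ⟨ht.le, ht1⟩
  refine le_trans (le_of_eq ?_) (measure_mono hsub)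
  rw [Measure.addHaar_ball_of_pos ν (z + _) (by positivity), mul_right_comm, ← mul_pow,
    ENNReal.ofReal_mul (by positivity), ENNReal.ofReal_toReal hb']
  congr 3
  ring

lemma LipschitzOnWith.euclideanHausdorffMeasure_image_le {X Y : Type*} [EMetricSpace X]
    [EMetricSpace Y] [MeasurableSpace X] [BorelSpace X] [MeasurableSpace Y] [BorelSpace Y]
    {K : ℝ≥0} {f : X → Y} {s : Set X} (h : LipschitzOnWith K f s) (d : ℕ) :
    (μHE[d] : Measure Y) (f '' s) ≤ (K : ℝ≥0∞) ^ d * (μHE[d] : Measure X) s := by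
  have h1 := h.hausdorffMeasure_image_le (d := d) (Nat.cast_nonneg d)
  rw [ENNReal.rpow_natCast] at h1
  rw [Measure.euclideanHausdorffMeasure_def, Measure.euclideanHausdorffMeasure_def,
    Measure.smul_apply, Measure.smul_apply, ENNReal.smul_def, ENNReal.smul_def, smul_eq_mul,
    smul_eq_mul, mul_left_comm]
  exact mul_le_mul_right h1 _

variable {E : Type*} [NormedAddCommGroup E] [NormedSpace ℝ E] [FiniteDimensional ℝ E]
  {H : Type*} [TopologicalSpace H] (I : ModelWithCorners ℝ E H)
  {X : Type*} [MetricSpace X] [ChartedSpace H X] [IsManifold I 1 X]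
  [RiemannianBundle (fun x : X => TangentSpace I x)]
  [IsContinuousRiemannianBundle E (fun x : X => TangentSpace I x)]
  [IsRiemannianManifold I X] [MeasurableSpace X] [BorelSpace X]

include I in
/-- The Riemannian volume of small balls of radius `r` is comparable to `r ^ D`. -/
theorem exists_euclideanHausdorffMeasure_ball_bounds (D : ℕ) (hD : Module.finrank ℝ E = D)
    (p : X) :
    ∃ c > 0, ∃ C > 0, ∃ r₀ > 0, ∀ r : ℝ, 0 < r → r < r₀ →
      ENNReal.ofReal (c * r ^ D) ≤ (μHE[D] : Measure X) (ball p r) ∧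
      (μHE[D] : Measure X) (ball p r) ≤ ENNReal.ofReal (C * r ^ D) := by
  let _ : MeasurableSpace E := borel E
  have : BorelSpace E := ⟨rfl⟩
  have : (μHE[D] : Measure E).IsAddHaarMeasure := by
    rw [← hD]; infer_instance
  obtain ⟨A, A_pos, a, a_pos, haT, hA⟩ := exists_lipschitzOnWith_extChartAt_symm I p
  obtain ⟨B, B_pos, b, b_pos, hbS, hB⟩ := exists_lipschitzOnWith_extChartAt I p
  have hz : extChartAt I p p ∈ range I :=
    extChartAt_target_subset_range p (mem_extChartAt_target p)
  obtain ⟨c, c_pos, hc⟩ := I.convex_range.exists_pow_le_measure_ball_inter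
    (μHE[D] : Measure E) I.nonempty_interior hz
  rw [hD] at hc
  have hV : 0 < (μHE[D] : Measure E) (ball 0 1) := measure_ball_pos _ _ one_pos
  have hV' : (μHE[D] : Measure E) (ball 0 1) ≠ ∞ := measure_ball_lt_top.ne
  have A_pos' : (0 : ℝ) < A := A_pos
  have B_pos' : (0 : ℝ) < B := B_pos
  refine ⟨c / (A * B) ^ D, by positivity,
    (A * B) ^ D * ((μHE[D] : Measure E) (ball 0 1)).toReal,
    mul_pos (by positivity) (ENNReal.toReal_pos hV.ne' hV'),
    min b (min A (min (A * a) (a / B))), by positivity, fun r r_pos hr => ?_⟩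
  simp only [lt_min_iff] at hr
  obtain ⟨hrb, hrA, hrAa, hraB⟩ := hr
  constructor
  · have h1 : ball (extChartAt I p p) (r / A) ∩ range I ⊆ extChartAt I p '' ball p r := by
      intro u hu
      have hu' : u ∈ ball (extChartAt I p p) a ∩ range I :=
        ⟨ball_subset_ball ((div_le_iff₀' A_pos').2 hrAa.le) hu.1, hu.2⟩
      refine ⟨(extChartAt I p).symm u, ?_, (extChartAt I p).right_inv (haT hu')⟩
      have h2 := hA.dist_le_mul u hu' _ ⟨mem_ball_self a_pos, hz⟩
      rw [(extChartAt I p).left_inv (mem_extChartAt_source p)] at h2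
      refine h2.trans_lt ?_
      have := hu.1
      rwa [mem_ball, lt_div_iff₀' A_pos'] at this
    have h2 := (hc (r / A) (by positivity) ((div_le_one A_pos').2 hrA.le)).trans
      ((measure_mono h1).trans
        ((hB.mono (ball_subset_ball hrb.le)).euclideanHausdorffMeasure_image_le D))
    have hBD : ((B : ℝ≥0∞) ^ D) = ENNReal.ofReal ((B : ℝ) ^ D) := by
      rw [ENNReal.ofReal_pow B_pos'.le, ENNReal.ofReal_coe_nnreal]
    have h3 : ENNReal.ofReal (c / (A * B) ^ D * r ^ D)
        = ENNReal.ofReal (c * (r / A) ^ D) / ENNReal.ofReal ((B : ℝ) ^ D) := by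
      rw [← ENNReal.ofReal_div_of_pos (by positivity)]
      congr 1
      rw [mul_pow, div_pow]
      field_simp
    rw [h3]
    refine ENNReal.div_le_of_le_mul' ?_
    rwa [hBD] at h2
  · have h1 : ball p r ⊆ (extChartAt I p).symm '' (ball (extChartAt I p p) (B * r) ∩ range I) := by
      intro x hx
      have hxb := ball_subset_ball hrb.le hx
      refine ⟨extChartAt I p x, ⟨?_, extChartAt_target_subset_range p
        ((extChartAt I p).map_source (hbS hxb))⟩, (extChartAt I p).left_inv (hbS hxb)⟩
      have h2 := hB.dist_le_mul x hxb p (mem_ball_self b_pos)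
      exact h2.trans_lt (mul_lt_mul_of_pos_left hx B_pos')
    have hBr : B * r ≤ a := by
      rw [lt_div_iff₀' B_pos'] at hraB
      exact hraB.le
    have hA' := (hA.mono (inter_subset_inter_left _
      (ball_subset_ball hBr))).euclideanHausdorffMeasure_image_le D
    refine (measure_mono h1).trans (hA'.trans ?_)
    refine (mul_le_mul_right (measure_mono inter_subset_left) _).trans (le_of_eq ?_)
    rw [Measure.addHaar_ball_of_pos _ _ (by positivity), hD,
      mul_assoc, ENNReal.ofReal_mul (by positivity), mul_comm _ (r ^ D),
      ENNReal.ofReal_mul (by positivity), ENNReal.ofReal_toReal hV', ← mul_assoc, ← mul_assoc]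
    congr 1
    rw [← ENNReal.ofReal_coe_nnreal, ← ENNReal.ofReal_pow A_pos'.le,
      ← ENNReal.ofReal_mul (by positivity), ← ENNReal.ofReal_mul (by positivity)]
    congr 1
    ring

include I in
/-- The invariant measure of small balls of radius `r` about a point where its density is bounded
is comparable to `r ^ D`. -/
theorem exists_measure_ball_bounds (D : ℕ) (hD : Module.finrank ℝ E = D) (μ : Measure X)
    (h : X → ℝ≥0∞) (hμ : μ = (μHE[D] : Measure X).withDensity h)
    (p : X) (hp : DensityBoundedAt (μHE[D] : Measure X) h p) :
    ∃ c > 0, ∃ C > 0, ∃ r₀ > 0, ∀ r : ℝ, 0 < r → r < r₀ →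
      ENNReal.ofReal (c * r ^ D) ≤ μ (ball p r) ∧ μ (ball p r) ≤ ENNReal.ofReal (C * r ^ D) := by
  obtain ⟨c, c_pos, C, C_pos, r₀, r₀_pos, hvol⟩ :=
    exists_euclideanHausdorffMeasure_ball_bounds I D hD p
  obtain ⟨C₁, C₂, C₁_pos, hC⟩ := hp
  obtain ⟨r₁, r₁_pos, hr₁⟩ := mem_nhdsGT_iff_exists_Ioo_subset.1 hC
  refine ⟨c * C₁, by positivity, C * max C₂ 1, by positivity, min r₀ r₁,
    lt_min r₀_pos r₁_pos, fun r r_pos hr => ?_⟩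
  rw [lt_min_iff] at hr
  obtain ⟨hv1, hv2⟩ := hvol r r_pos hr.1
  obtain ⟨ha1, ha2⟩ := hr₁ ⟨r_pos, hr.2⟩
  have hm0 : (μHE[D] : Measure X) (ball p r) ≠ 0 :=
    ((ENNReal.ofReal_pos.2 (by positivity)).trans_le hv1).ne'
  have hmt : (μHE[D] : Measure X) (ball p r) ≠ ∞ := (hv2.trans_lt ENNReal.ofReal_lt_top).ne
  have hμr : μ (ball p r) = (μHE[D] : Measure X) (ball p r) *
      ⨍⁻ x in ball p r, h x ∂(μHE[D] : Measure X) := by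
    rw [hμ, withDensity_apply _ measurableSet_ball, setLAverage_eq,
      ENNReal.mul_div_cancel hm0 hmt]
  rw [hμr]
  constructor
  · rw [mul_right_comm, ENNReal.ofReal_mul (by positivity)]
    exact mul_le_mul' hv1 ha1
  · rw [mul_right_comm, ENNReal.ofReal_mul (by positivity)]
    exact mul_le_mul' hv2 (ha2.trans (ENNReal.ofReal_le_ofReal (le_max_left _ _)))

end Volume

section UpperBound

open Set Metric

lemma exists_measure_ball_le_pow {X : Type*} [MetricSpace X] [MeasurableSpace X] {μ : Measure X}
    [IsProbabilityMeasure μ] {p : X} {D : ℕ} {C r₀ : ℝ} (hr₀ : 0 < r₀)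
    (h : ∀ r : ℝ, 0 < r → r < r₀ → μ (ball p r) ≤ ENNReal.ofReal (C * r ^ D)) :
    ∃ C' > 0, ∀ r : ℝ, 0 < r → μ (ball p r) ≤ ENNReal.ofReal (C' * r ^ D) := by
  refine ⟨max C (1 / r₀ ^ D), lt_max_of_lt_right (by positivity), fun r r_pos => ?_⟩
  rcases lt_or_ge r r₀ with hr | hr
  · refine (h r r_pos hr).trans (ENNReal.ofReal_le_ofReal ?_)
    gcongr
    exact le_max_left _ _
  · refine prob_le_one.trans ?_
    rw [← ENNReal.ofReal_one]
    refine ENNReal.ofReal_le_ofReal ?_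
    calc (1 : ℝ) = 1 / r₀ ^ D * r₀ ^ D := by field_simp
      _ ≤ max C (1 / r₀ ^ D) * r ^ D := by
        gcongr
        exact le_max_right _ _

/-- A dyadic majorant of the truncated pole. -/
lemma min_poleObservable_div_le_tsum {X : Type*} [MetricSpace X] (p : X) {k s : ℝ} (hk : 0 < k)
    (hs : 0 < s) (x : X) :
    min (poleObservable p k x / ENNReal.ofReal (s ^ (-k))) 1 ≤
      ∑' i : ℕ, ENNReal.ofReal (((2 : ℝ) ^ (-k)) ^ i) *
        (ball p (2 ^ (i + 1) * s)).indicator 1 x := by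
  rcases lt_or_ge (dist x p) s with hd | hd
  · refine (min_le_right _ _).trans (le_trans ?_ (ENNReal.le_tsum 0))
    have : x ∈ ball p (2 ^ (0 + 1) * s) := by
      rw [mem_ball, zero_add, pow_one]
      linarith
    rw [indicator_of_mem this]
    simp
  · have d_pos : 0 < dist x p := hs.trans_le hd
    obtain ⟨n, hn1, hn2⟩ := exists_nat_pow_near ((one_le_div hs).2 hd) (one_lt_two (α := ℝ))
    refine (min_le_left _ _).trans (le_trans ?_ (ENNReal.le_tsum n))
    have hx : x ∈ ball p (2 ^ (n + 1) * s) := (div_lt_iff₀ hs).1 hn2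
    rw [indicator_of_mem hx, Pi.one_apply, mul_one, poleObservable, edist_dist,
      ENNReal.ofReal_rpow_of_pos d_pos, ← ENNReal.ofReal_div_of_pos (by positivity),
      ← Real.div_rpow d_pos.le hs.le]
    refine ENNReal.ofReal_le_ofReal ?_
    rw [← Real.rpow_natCast, ← Real.rpow_mul two_pos.le, mul_comm, Real.rpow_mul two_pos.le,
      Real.rpow_natCast]
    exact Real.rpow_le_rpow_of_nonpos (by positivity) hn1 (by linarith)

lemma exists_lintegral_min_poleObservable_le {X : Type*} [MetricSpace X] [MeasurableSpace X]
    [BorelSpace X] {μ : Measure X} {p : X} {D : ℕ} {C k : ℝ} (hC : 0 < C) (hDk : (D : ℝ) < k)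
    (h : ∀ r : ℝ, 0 < r → μ (ball p r) ≤ ENNReal.ofReal (C * r ^ D)) :
    ∃ C' > 0, ∀ c : ℝ, 0 < c →
      ∫⁻ x, min (poleObservable p k x / ENNReal.ofReal c) 1 ∂μ ≤
        ENNReal.ofReal (C' * c ^ (-(D / k))) := by
  have hk : 0 < k := (Nat.cast_nonneg D).trans_lt hDk
  set q : ℝ := (2 : ℝ) ^ (-k) with hq
  have q_pos : 0 < q := by positivity
  have hq1 : q * 2 ^ D < 1 := by
    rw [hq, ← Real.rpow_natCast, ← Real.rpow_add two_pos]
    exact Real.rpow_lt_one_of_one_lt_of_neg one_lt_two (by linarith)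
  refine ⟨C * 2 ^ D * (1 - q * 2 ^ D)⁻¹, mul_pos (by positivity) (inv_pos.2 (by linarith)),
    fun c c_pos => ?_⟩
  set s : ℝ := c ^ (-(1 / k)) with hs
  have s_pos : 0 < s := by positivity
  have hsk : s ^ (-k) = c := by
    rw [hs, ← Real.rpow_mul c_pos.le, neg_mul_neg, one_div_mul_cancel hk.ne', Real.rpow_one]
  have hsD : s ^ D = c ^ (-(D / k)) := by
    rw [hs, ← Real.rpow_natCast, ← Real.rpow_mul c_pos.le]
    congr 1
    ring
  calc ∫⁻ x, min (poleObservable p k x / ENNReal.ofReal c) 1 ∂μ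
      ≤ ∫⁻ x, ∑' i : ℕ, ENNReal.ofReal (q ^ i) * (ball p (2 ^ (i + 1) * s)).indicator 1 x ∂μ := by
        refine lintegral_mono fun x => ?_
        rw [← hsk]
        exact min_poleObservable_div_le_tsum p hk s_pos x
    _ = ∑' i : ℕ, ENNReal.ofReal (q ^ i) * μ (ball p (2 ^ (i + 1) * s)) := by
        rw [lintegral_tsum fun i =>
          ((measurable_one.indicator measurableSet_ball).const_mul _).aemeasurable]
        congr 1 with i
        rw [lintegral_const_mul _ (measurable_one.indicator measurableSet_ball),
          lintegral_indicator_one measurableSet_ball]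
    _ ≤ ∑' i : ℕ, ENNReal.ofReal (C * 2 ^ D * s ^ D * (q * 2 ^ D) ^ i) := by
        refine ENNReal.tsum_le_tsum fun i => ?_
        refine (mul_le_mul_right (h _ (by positivity)) _).trans (le_of_eq ?_)
        rw [← ENNReal.ofReal_mul (by positivity)]
        congr 1
        rw [mul_pow, mul_pow, ← pow_mul, ← pow_mul]
        ring
    _ = ENNReal.ofReal (C * 2 ^ D * s ^ D * (1 - q * 2 ^ D)⁻¹) := by
        have hsum := summable_geometric_of_lt_one (by positivity) hq1
        rw [← ENNReal.ofReal_tsum_of_nonneg (fun i => by positivity) (hsum.mul_left _),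
          tsum_mul_left, tsum_geometric_of_lt_one (by positivity) hq1]
    _ = _ := by
        rw [hsD]
        congr 1
        ring

lemma summable_one_div_mul_log_rpow {δ : ℝ} (hδ : 0 < δ) :
    Summable fun n : ℕ => (((n : ℝ) + 1) * Real.log (n + 2) ^ (1 + δ))⁻¹ := by
  have hlog : ∀ n : ℕ, 0 < Real.log ((n : ℝ) + 2) := fun n =>
    Real.log_pos (by have := Nat.cast_nonneg (α := ℝ) n; linarith)
  rw [← summable_condensed_iff_of_nonneg]
  · have hs : Summable fun n : ℕ => (Real.log 2 / 2) ^ (-(1 + δ)) * (((n + 1 : ℕ) : ℝ) ^ (1 + δ))⁻¹ :=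
      ((summable_nat_add_iff 1).2 (Real.summable_nat_rpow_inv.2 (by linarith))).mul_left _
    refine hs.of_nonneg_of_le (fun n => by have := (hlog (2 ^ n)).le; positivity) fun n => ?_
    have h2 : 0 < Real.log 2 := Real.log_pos one_lt_two
    have h1 : Real.log 2 / 2 * (n + 1 : ℕ) ≤ Real.log (((2 ^ n : ℕ) : ℝ) + 2) := by
      have ha : (n : ℝ) * Real.log 2 ≤ Real.log (((2 ^ n : ℕ) : ℝ) + 2) := by
        rw [← Real.log_pow]
        exact Real.log_le_log (by positivity) (by push_cast; linarith)
      have hb : Real.log 2 ≤ Real.log (((2 ^ n : ℕ) : ℝ) + 2) :=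
        Real.log_le_log two_pos (by have := Nat.cast_nonneg (α := ℝ) (2 ^ n); linarith)
      push_cast at ha hb ⊢
      nlinarith
    have h3 := Real.rpow_le_rpow (by positivity) h1 (by linarith : 0 ≤ 1 + δ)
    rw [Real.mul_rpow (by positivity) (by positivity)] at h3
    rw [Real.rpow_neg (by positivity), ← mul_inv, mul_inv (((2 ^ n : ℕ) : ℝ) + 1), ← mul_assoc]
    have h4 : (2 : ℝ) ^ n * (((2 ^ n : ℕ) : ℝ) + 1)⁻¹ ≤ 1 := by
      push_cast
      rw [mul_inv_le_iff₀ (by positivity)]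
      linarith
    calc _ ≤ 1 * (Real.log (((2 ^ n : ℕ) : ℝ) + 2) ^ (1 + δ))⁻¹ := by
          have := (hlog (2 ^ n)).le
          gcongr
      _ ≤ _ := by
          rw [one_mul]
          exact inv_anti₀ (by positivity) h3
  · intro n
    have := hlog n
    positivity
  · intro m n _ hmn
    have hm := hlog m
    have : (m : ℝ) ≤ n := by exact_mod_cast hmn
    gcongr

/-- A form of Kronecker's lemma in `ℝ≥0∞`. -/
lemma ENNReal.tendsto_sum_div_of_tsum_div_ne_top {a c : ℕ → ℝ≥0∞} (ha : ∀ n, a n ≠ ∞)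
    (hc : Monotone c) (hct : Tendsto c atTop (𝓝 ∞))
    (h : ∑' n, a n / c n ≠ ∞) :
    Tendsto (fun n => (∑ j ∈ Finset.range n, a j) / c n) atTop (𝓝 0) := by
  have h1 : ∀ n, (∑ j ∈ Finset.range n, a j) / c n =
      ∫⁻ j, (if j < n then a j / c n else 0) ∂Measure.count := by
    intro n
    rw [lintegral_count, tsum_eq_sum (s := Finset.range n)
      (fun j hj => if_neg (by simpa using hj)), div_eq_mul_inv, Finset.sum_mul]
    refine Finset.sum_congr rfl fun j hj => ?_
    rw [if_pos (Finset.mem_range.1 hj), div_eq_mul_inv]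
  simp_rw [h1]
  have h2 := tendsto_lintegral_of_dominated_convergence (μ := (Measure.count : Measure ℕ))
    (F := fun n j => if j < n then a j / c n else 0) (f := fun _ => 0) (fun j => a j / c j)
    (fun n => measurable_of_countable _)
    (fun n => ae_of_all _ fun j => ?_) (by rwa [lintegral_count]) (ae_of_all _ fun j => ?_)
  · simpa using h2
  · dsimp only
    split_ifs with hj
    · exact ENNReal.div_le_div_left (hc hj.le) _
    · exact zero_le
  · have h3 : Tendsto (fun n => a j / c n) atTop (𝓝 0) := by
      have := ENNReal.Tendsto.const_div hct (Or.inr (ha j))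
      rwa [ENNReal.div_top] at this
    refine tendsto_of_tendsto_of_tendsto_of_le_of_le tendsto_const_nhds h3 (fun n => zero_le)
      fun n => ?_
    dsimp only
    split_ifs
    · exact le_rfl
    · exact zero_le

lemma measurable_poleObservable {X : Type*} [MetricSpace X] [MeasurableSpace X] [BorelSpace X]
    (p : X) (k : ℝ) : Measurable (poleObservable p k) :=
  (measurable_edist_left).pow_const _

lemma poleObservable_ne_top {X : Type*} [MetricSpace X] {p x : X} {k : ℝ} (hx : x ≠ p) :
    poleObservable p k x ≠ ∞ := by
  rw [poleObservable, edist_dist, ENNReal.ofReal_rpow_of_pos (dist_pos.2 hx)]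
  exact ENNReal.ofReal_ne_top

lemma measure_singleton_eq_zero_of_ball_le_pow {X : Type*} [MetricSpace X] [MeasurableSpace X]
    {μ : Measure X} {p : X} {D : ℕ} (hD : 1 ≤ D) {C : ℝ}
    (h : ∀ r : ℝ, 0 < r → μ (ball p r) ≤ ENNReal.ofReal (C * r ^ D)) : μ {p} = 0 := by
  have h1 : Tendsto (fun r : ℝ => ENNReal.ofReal (C * r ^ D)) (𝓝[>] 0) (𝓝 0) := by
    have h2 : Continuous fun r : ℝ => ENNReal.ofReal (C * r ^ D) :=
      ENNReal.continuous_ofReal.comp (by fun_prop)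
    have h3 := h2.tendsto 0
    rw [zero_pow (by lia), mul_zero, ENNReal.ofReal_zero] at h3
    exact h3.mono_left nhdsWithin_le_nhds
  refine le_antisymm (ge_of_tendsto h1 ?_) zero_le
  filter_upwards [self_mem_nhdsWithin] with r hr
  exact (measure_mono (singleton_subset_iff.2 (mem_ball_self hr))).trans (h r hr)

/-- If `φ` has a pole of order `k > D`, then the Birkhoff sums of `φ` under any measure preserving
map are `o(n ^ (k / D) (log n) ^ (k / D + ε))`. -/
theorem ae_tendsto_birkhoffS_div_zero {X : Type*} [MetricSpace X] [MeasurableSpace X]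
    [BorelSpace X] {T : X → X} {μ : Measure X} [IsProbabilityMeasure μ]
    (hT : MeasurePreserving T μ μ) {p : X} {D : ℕ} (hD : 1 ≤ D) {C k : ℝ} (hC : 0 < C)
    (hDk : (D : ℝ) < k) (h : ∀ r : ℝ, 0 < r → μ (ball p r) ≤ ENNReal.ofReal (C * r ^ D))
    {ε : ℝ} (hε : 0 < ε) :
    ∀ᵐ x ∂μ, Tendsto (fun n : ℕ => birkhoffS T (poleObservable p k) n x /
        ENNReal.ofReal ((n : ℝ) ^ (k / D) * Real.log n ^ (k / D + ε))) atTop (𝓝 0) := by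
  have hD0 : (0 : ℝ) < D := by exact_mod_cast hD
  have hk : 0 < k := hD0.trans hDk
  obtain ⟨C', C'_pos, hC'⟩ := exists_lintegral_min_poleObservable_le hC hDk h
  set c : ℕ → ℝ := fun n => ((n : ℝ) + 1) ^ (k / D) * Real.log (n + 2) ^ (k / D + ε) with hc
  have hlog : ∀ n : ℕ, 0 < Real.log ((n : ℝ) + 2) := fun n =>
    Real.log_pos (by have := Nat.cast_nonneg (α := ℝ) n; linarith)
  have c_pos : ∀ n, 0 < c n := fun n => by have := hlog n; positivity
  have c_mono : Monotone c := fun m n hmn => by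
    have hm := hlog m
    have : (m : ℝ) ≤ n := by exact_mod_cast hmn
    simp only [hc]
    gcongr
  have c_tendsto : Tendsto c atTop atTop := by
    have h1 : Tendsto (fun n : ℕ => (n : ℝ)) atTop atTop := tendsto_natCast_atTop_atTop
    refine Tendsto.atTop_mul_atTop₀ ?_ ?_
    · exact (tendsto_rpow_atTop (by positivity)).comp (tendsto_atTop_add_const_right _ _ h1)
    · exact (tendsto_rpow_atTop (by positivity)).comp
        (Real.tendsto_log_atTop.comp (tendsto_atTop_add_const_right _ _ h1))
  have c_rpow : ∀ n : ℕ, c n ^ (-(D / k)) =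
      (((n : ℝ) + 1) * Real.log (n + 2) ^ (1 + ε * (D / k)))⁻¹ := fun n => by
    have hm := hlog n
    simp only [hc]
    rw [Real.rpow_neg (by positivity), Real.mul_rpow (by positivity) (by positivity),
      ← Real.rpow_mul (by positivity), ← Real.rpow_mul (by positivity)]
    congr 3
    · rw [div_mul_div_cancel₀ hD0.ne', div_self hk.ne', Real.rpow_one]
    · field_simp
  set g : ℕ → X → ℝ≥0∞ := fun n x => min (poleObservable p k x / ENNReal.ofReal (c n)) 1 with hg
  have hgm : ∀ n, Measurable (g n) := fun n =>
    ((measurable_poleObservable p k).div_const _).min measurable_const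
  have hgT : ∀ n, AEMeasurable (fun x => g n (T^[n] x)) μ := fun n =>
    ((hgm n).comp (hT.iterate n).measurable).aemeasurable
  have hint : ∫⁻ x, ∑' n : ℕ, g n (T^[n] x) ∂μ ≠ ∞ := by
    rw [lintegral_tsum hgT]
    have h1 : ∀ n, ∫⁻ x, g n (T^[n] x) ∂μ ≤ ENNReal.ofReal (C' * c n ^ (-(D / k))) := fun n => by
      rw [(hT.iterate n).lintegral_comp (hgm n)]
      exact hC' _ (c_pos n)
    refine ne_top_of_le_ne_top ?_ (ENNReal.tsum_le_tsum h1)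
    have hs : Summable fun n => C' * c n ^ (-(D / k)) := by
      simp_rw [c_rpow]
      exact (summable_one_div_mul_log_rpow (by positivity)).mul_left _
    rw [← ENNReal.ofReal_tsum_of_nonneg (fun n => by have := c_pos n; positivity) hs]
    exact ENNReal.ofReal_ne_top
  have hp0 := measure_singleton_eq_zero_of_ball_le_pow hD h
  have hne : ∀ᵐ x ∂μ, ∀ n : ℕ, T^[n] x ≠ p := by
    refine ae_all_iff.2 fun n => ?_
    have h1 : μ (T^[n] ⁻¹' {p}) = 0 := by
      rw [(hT.iterate n).measure_preimage (measurableSet_singleton p).nullMeasurableSet, hp0]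
    rw [ae_iff]
    convert h1 using 2
    ext x
    simp
  have hfin := ae_lt_top' (AEMeasurable.tsum hgT) hint
  filter_upwards [hne, hfin] with x hx hxf
  have ha : ∀ n, poleObservable p k (T^[n] x) ≠ ∞ := fun n => poleObservable_ne_top (hx n)
  have hsum : ∑' n, poleObservable p k (T^[n] x) / ENNReal.ofReal (c n) ≠ ∞ := by
    have h0 := ENNReal.tendsto_atTop_zero_of_tsum_ne_top hxf.ne
    obtain ⟨m, hm⟩ := eventually_atTop.1 (h0.eventually_lt_const one_pos)
    have hterm : ∀ n, poleObservable p k (T^[n] x) / ENNReal.ofReal (c n) ≠ ∞ := fun n =>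
      ENNReal.div_ne_top (ha n) (ENNReal.ofReal_pos.2 (c_pos n)).ne'
    rw [← ENNReal.summable.sum_add_tsum_nat_add' (k := m)]
    refine ENNReal.add_ne_top.2 ⟨ENNReal.sum_ne_top.2 fun n _ => hterm n, ?_⟩
    refine ne_top_of_le_ne_top hxf.ne (le_trans (le_of_eq ?_)
      (ENNReal.tsum_comp_le_tsum_of_injective (add_left_injective m) _))
    refine tsum_congr fun n => ?_
    have := hm (n + m) (Nat.le_add_left _ _)
    simp only [hg] at this ⊢
    exact (min_eq_left ((min_lt_iff.1 this).resolve_right (lt_irrefl _)).le).symm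
  have hK := ENNReal.tendsto_sum_div_of_tsum_div_ne_top ha
    (fun m n hmn => ENNReal.ofReal_le_ofReal (c_mono hmn))
    (ENNReal.tendsto_ofReal_nhds_top.2 c_tendsto) hsum
  set M : ℝ := 2 ^ (k / D) * 2 ^ (k / D + ε) with hM
  have hK' : Tendsto (fun n => ENNReal.ofReal M *
      ((∑ j ∈ Finset.range n, poleObservable p k (T^[j] x)) / ENNReal.ofReal (c n)))
      atTop (𝓝 0) := by
    have := ENNReal.Tendsto.const_mul (a := ENNReal.ofReal M) hK (Or.inr ENNReal.ofReal_ne_top)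
    rwa [mul_zero] at this
  refine tendsto_of_tendsto_of_tendsto_of_le_of_le' tendsto_const_nhds hK'
    (Eventually.of_forall fun n => zero_le) ?_
  filter_upwards [eventually_ge_atTop 2] with n hn
  have hn' : (2 : ℝ) ≤ n := by exact_mod_cast hn
  have hln : 0 < Real.log n := Real.log_pos (by linarith)
  have hcn : c n ≤ M * ((n : ℝ) ^ (k / D) * Real.log n ^ (k / D + ε)) := by
    have h1 : Real.log ((n : ℝ) + 2) ≤ 2 * Real.log n := by
      rw [← Nat.cast_ofNat (R := ℝ) (n := 2), ← Real.log_pow]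
      push_cast
      exact Real.log_le_log (by linarith) (by nlinarith)
    have h2 : (n : ℝ) + 1 ≤ 2 * n := by linarith
    calc c n ≤ (2 * (n : ℝ)) ^ (k / D) * (2 * Real.log n) ^ (k / D + ε) := by
          have := hlog n
          simp only [hc]
          gcongr
      _ = _ := by
          rw [Real.mul_rpow (by positivity) (by positivity),
            Real.mul_rpow (by positivity) (by positivity), hM]
          ring
  have hb : 0 < (n : ℝ) ^ (k / D) * Real.log n ^ (k / D + ε) := by positivity
  rw [birkhoffS, ENNReal.div_eq_inv_mul, ENNReal.div_eq_inv_mul, ← mul_assoc]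
  refine mul_le_mul_left ?_ _
  rw [← ENNReal.ofReal_inv_of_pos hb, ← ENNReal.ofReal_inv_of_pos (c_pos n),
    ← ENNReal.ofReal_mul (by positivity)]
  refine ENNReal.ofReal_le_ofReal ?_
  rw [← div_eq_mul_inv, inv_eq_one_div, div_le_div_iff₀ hb (c_pos n), one_mul]
  exact hcn

end UpperBound

section LowerBound

open Set Metric

lemma sum_range_ite_abs_lt_le (n K i : ℕ) {e : ℝ} (he : 0 ≤ e) :
    ∑ j ∈ Finset.range n, (if i < j + K ∧ j < i + K then e else 0) ≤ 2 * K * e := by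
  rw [← Finset.sum_filter, Finset.sum_const, nsmul_eq_mul]
  refine mul_le_mul_of_nonneg_right ?_ he
  have h1 : ((Finset.range n).filter fun j => i < j + K ∧ j < i + K) ⊆
      Finset.Ico (i + 1 - K) (i + K) := by
    intro j hj
    simp only [Finset.mem_filter, Finset.mem_Ico] at hj ⊢
    lia
  have h2 := Finset.card_le_card h1
  rw [Nat.card_Ico] at h2
  exact_mod_cast (by lia : _ ≤ 2 * K)

/-- A second moment estimate: if the correlations of `f` and `f ∘ T^m` are at most `B` for
`m ≥ K`, then the Birkhoff sums of `f` are rarely smaller than half of their mean. -/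
lemma measureReal_birkhoff_le_half_mean {X : Type*} [MeasurableSpace X] {T : X → X}
    {μ : Measure X} [IsProbabilityMeasure μ] (hT : MeasurePreserving T μ μ) {f : X → ℝ}
    (hf : Measurable f) (hf0 : ∀ x, 0 ≤ f x) (hf1 : ∀ x, f x ≤ 1) (he : 0 < ∫ x, f x ∂μ)
    {B : ℝ} {K : ℕ} (hB0 : 0 ≤ B)
    (hB : ∀ m, K ≤ m → (∫ x, f x * f (T^[m] x) ∂μ) - (∫ x, f x ∂μ) * ∫ x, f x ∂μ ≤ B)
    {n : ℕ} (hn : 0 < n) :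
    μ.real {x | ∑ j ∈ Finset.range n, f (T^[j] x) ≤ n * (∫ x, f x ∂μ) / 2} ≤
      8 * K / (n * ∫ x, f x ∂μ) + 4 * B / (∫ x, f x ∂μ) ^ 2 := by
  set e := ∫ x, f x ∂μ with he'
  have hfT : ∀ j, Measurable fun x => f (T^[j] x) := fun j => hf.comp (hT.iterate j).measurable
  have hint : ∀ {g : X → ℝ}, Measurable g → (∀ x, 0 ≤ g x) → (∀ x, g x ≤ 1) → Integrable g μ :=
    fun hg h0 h1 => Integrable.of_bound hg.aestronglyMeasurable 1
      (ae_of_all _ fun x => by rw [Real.norm_of_nonneg (h0 x)]; exact h1 x)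
  have hi1 : ∀ j, Integrable (fun x => f (T^[j] x)) μ := fun j =>
    hint (hfT j) (fun x => hf0 _) fun x => hf1 _
  have hi2 : ∀ i j, Integrable (fun x => f (T^[i] x) * f (T^[j] x)) μ := fun i j =>
    hint ((hfT i).mul (hfT j)) (fun x => mul_nonneg (hf0 _) (hf0 _))
      fun x => mul_le_one₀ (hf1 _) (hf0 _) (hf1 _)
  have hmean : ∀ j, ∫ x, f (T^[j] x) ∂μ = e := fun j => by
    have := integral_map (μ := μ) (hT.iterate j).measurable.aemeasurable (f := f)
      hf.aestronglyMeasurable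
    rw [(hT.iterate j).map_eq] at this
    exact this.symm
  have hshift : ∀ i m, ∫ x, f (T^[i] x) * f (T^[i + m] x) ∂μ = ∫ x, f x * f (T^[m] x) ∂μ := by
    intro i m
    have := integral_map (μ := μ) (hT.iterate i).measurable.aemeasurable
      (f := fun x => f x * f (T^[m] x)) (hf.mul (hfT m)).aestronglyMeasurable
    rw [(hT.iterate i).map_eq] at this
    rw [this]
    simp_rw [← Function.iterate_add_apply, add_comm i m]
  have hcov : ∀ i j, (∫ x, (f (T^[i] x) - e) * (f (T^[j] x) - e) ∂μ) =
      (∫ x, f (T^[i] x) * f (T^[j] x) ∂μ) - e * e := by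
    intro i j
    have h1 : ∀ x, (f (T^[i] x) - e) * (f (T^[j] x) - e) =
        f (T^[i] x) * f (T^[j] x) - e * f (T^[i] x) - e * f (T^[j] x) + e * e := fun x => by ring
    have h2 : Integrable (fun x => f (T^[i] x) * f (T^[j] x) - e * f (T^[i] x)) μ :=
      (hi2 i j).sub ((hi1 i).const_mul e)
    have h3 : Integrable
        (fun x => f (T^[i] x) * f (T^[j] x) - e * f (T^[i] x) - e * f (T^[j] x)) μ :=
      h2.sub ((hi1 j).const_mul e)
    simp_rw [h1]
    rw [integral_add h3 (integrable_const _), integral_sub h2 ((hi1 j).const_mul e),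
      integral_sub (hi2 i j) ((hi1 i).const_mul e), integral_const_mul, integral_const_mul,
      hmean, hmean, integral_const]
    simp
  have hle : ∀ i j, (∫ x, f (T^[i] x) * f (T^[j] x) ∂μ) ≤ e := fun i j => by
    rw [← hmean i]
    exact integral_mono (hi2 i j) (hi1 i) fun x => mul_le_of_le_one_right (hf0 _) (hf1 _)
  have hbound : ∀ i j, (∫ x, (f (T^[i] x) - e) * (f (T^[j] x) - e) ∂μ) ≤
      (if i < j + K ∧ j < i + K then e else 0) + B := by
    intro i j
    rw [hcov]
    split_ifs with hij
    · have := hle i j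
      nlinarith [mul_pos he he]
    · rw [zero_add]
      rcases le_total i j with h | h
      · obtain ⟨m, rfl⟩ := Nat.exists_eq_add_of_le h
        rw [hshift]
        exact hB m (by lia)
      · obtain ⟨m, rfl⟩ := Nat.exists_eq_add_of_le h
        simp_rw [mul_comm (f (T^[j + m] _))]
        rw [hshift]
        exact hB m (by lia)
  have hsq : ∀ x, (∑ j ∈ Finset.range n, f (T^[j] x) - n * e) ^ 2 =
      ∑ i ∈ Finset.range n, ∑ j ∈ Finset.range n, (f (T^[i] x) - e) * (f (T^[j] x) - e) := by
    intro x
    rw [← Finset.sum_mul_sum, Finset.sum_sub_distrib]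
    simp [sq]
  have hi3 : ∀ i j, Integrable (fun x => (f (T^[i] x) - e) * (f (T^[j] x) - e)) μ := by
    intro i j
    have h1 : (fun x => (f (T^[i] x) - e) * (f (T^[j] x) - e)) = fun x =>
        f (T^[i] x) * f (T^[j] x) - e * f (T^[i] x) - e * f (T^[j] x) + e * e := by
      ext x; ring
    rw [h1]
    exact (((hi2 i j).sub ((hi1 i).const_mul e)).sub ((hi1 j).const_mul e)).add
      (integrable_const _)
  have hvar : ∫ x, (∑ j ∈ Finset.range n, f (T^[j] x) - n * e) ^ 2 ∂μ ≤
      n * (2 * K * e) + n ^ 2 * B := by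
    simp_rw [hsq]
    rw [integral_finsetSum _ fun i _ => integrable_finsetSum _ fun j _ => hi3 i j]
    simp_rw [integral_finsetSum _ fun j _ => hi3 _ j]
    calc _ ≤ ∑ i ∈ Finset.range n, ∑ j ∈ Finset.range n,
          ((if i < j + K ∧ j < i + K then e else 0) + B) :=
          Finset.sum_le_sum fun i _ => Finset.sum_le_sum fun j _ => hbound i j
      _ ≤ ∑ i ∈ Finset.range n, (2 * K * e + n * B) := by
          refine Finset.sum_le_sum fun i _ => ?_
          rw [Finset.sum_add_distrib]
          refine add_le_add (sum_range_ite_abs_lt_le n K i he.le) ?_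
          simp
      _ = _ := by
          simp
          ring
  have hn' : (0 : ℝ) < n := by exact_mod_cast hn
  have hmarkov := mul_meas_ge_le_integral_of_nonneg (μ := μ)
    (f := fun x => (∑ j ∈ Finset.range n, f (T^[j] x) - n * e) ^ 2)
    (ae_of_all _ fun x => sq_nonneg _)
    (by
      simp_rw [hsq]
      exact integrable_finsetSum _ fun i _ => integrable_finsetSum _ fun j _ => hi3 i j)
    ((n * e / 2) ^ 2)
  have hsub : {x | ∑ j ∈ Finset.range n, f (T^[j] x) ≤ n * e / 2} ⊆
      {x | (n * e / 2) ^ 2 ≤ (∑ j ∈ Finset.range n, f (T^[j] x) - n * e) ^ 2} := by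
    intro x hx
    rw [mem_ofPred_eq] at hx ⊢
    have : 0 < n * e := by positivity
    nlinarith
  have h1 := measureReal_mono (μ := μ) hsub
  have h2 : (n * e / 2) ^ 2 * μ.real {x | ∑ j ∈ Finset.range n, f (T^[j] x) ≤ n * e / 2} ≤
      n * (2 * K * e) + n ^ 2 * B :=
    (mul_le_mul_of_nonneg_left h1 (sq_nonneg _)).trans (hmarkov.trans hvar)
  have h3 : 8 * K / (n * e) + 4 * B / e ^ 2 =
      (n * (2 * K * e) + n ^ 2 * B) / (n * e / 2) ^ 2 := by
    field_simp
    ring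
  rw [h3, le_div_iff₀' (by positivity)]
  exact h2

/-- A Lipschitz bump which is `1` on the ball of radius `r / 2` about `p` and vanishes outside the
ball of radius `r`. -/
noncomputable def ballBump {X : Type*} [MetricSpace X] (p : X) (r : ℝ) (x : X) : ℝ :=
  max 0 (min 1 (2 - 2 / r * dist x p))

section BallBump

variable {X : Type*} [MetricSpace X] (p : X) {r : ℝ}

lemma ballBump_nonneg (x : X) : 0 ≤ ballBump p r x := le_max_left _ _

lemma ballBump_le_one (x : X) : ballBump p r x ≤ 1 := max_le zero_le_one (min_le_left _ _)

lemma ballBump_eq_zero (hr : 0 < r) {x : X} (hx : r ≤ dist x p) : ballBump p r x = 0 := by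
  have h1 : 2 / r * r ≤ 2 / r * dist x p := mul_le_mul_of_nonneg_left hx (by positivity)
  rw [div_mul_cancel₀ _ hr.ne'] at h1
  exact max_eq_left ((min_le_right _ _).trans (by linarith))

lemma ballBump_eq_one (hr : 0 < r) {x : X} (hx : x ∈ ball p (r / 2)) : ballBump p r x = 1 := by
  have h1 : 2 / r * dist x p ≤ 2 / r * (r / 2) :=
    mul_le_mul_of_nonneg_left (mem_ball.1 hx).le (by positivity)
  rw [div_mul_div_cancel₀ hr.ne', div_self two_ne_zero] at h1
  rw [ballBump, min_eq_left (by linarith), max_eq_right zero_le_one]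

lemma abs_ballBump_sub_le (hr : 0 < r) (x y : X) :
    |ballBump p r x - ballBump p r y| ≤ 2 / r * dist x y := by
  have h1 : |ballBump p r x - ballBump p r y| ≤
      |(2 - 2 / r * dist x p) - (2 - 2 / r * dist y p)| :=
    (abs_max_sub_max_le_max _ _ _ _).trans (by
      rw [sub_self, abs_zero, max_eq_right (abs_nonneg _)]
      refine (abs_min_sub_min_le_max _ _ _ _).trans ?_
      rw [sub_self, abs_zero, max_eq_right (abs_nonneg _)])
  refine h1.trans ?_
  rw [show (2 - 2 / r * dist x p) - (2 - 2 / r * dist y p) = 2 / r * (dist y p - dist x p) by ring,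
    abs_mul, abs_of_pos (by positivity : 0 < 2 / r)]
  refine mul_le_mul_of_nonneg_left ?_ (by positivity)
  rw [abs_sub_comm]
  exact abs_dist_sub_le x y p

lemma isBddLipschitz_ballBump (hr : 0 < r) : IsBddLipschitz (ballBump p r) := by
  refine ⟨⟨⟨2 / r, by positivity⟩, LipschitzWith.of_dist_le_mul fun x y => ?_⟩, 1, fun x => ?_⟩
  · exact abs_ballBump_sub_le p hr x y
  · rw [abs_of_nonneg (ballBump_nonneg p x)]
    exact ballBump_le_one p x

lemma lipNorm_ballBump_le (hr : 0 < r) : lipNorm (ballBump p r) ≤ 1 + 2 / r := by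
  have : Nonempty X := ⟨p⟩
  refine add_le_add (ciSup_le fun x => ?_) (csInf_le ⟨0, fun K hK => hK.1⟩ ⟨by positivity, ?_⟩)
  · rw [abs_of_nonneg (ballBump_nonneg p x)]
    exact ballBump_le_one p x
  · exact abs_ballBump_sub_le p hr

lemma lipNorm_nonneg (f : X → ℝ) : 0 ≤ lipNorm f :=
  add_nonneg (Real.iSup_nonneg fun _ => abs_nonneg _) (Real.sInf_nonneg fun _ hK => hK.1)

variable [MeasurableSpace X] [BorelSpace X]

lemma measurable_ballBump : Measurable (ballBump p r) := by
  refine Continuous.measurable ?_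
  unfold ballBump
  fun_prop

lemma measureReal_ball_le_integral_ballBump (μ : Measure X) [IsProbabilityMeasure μ]
    (hr : 0 < r) : μ.real (ball p (r / 2)) ≤ ∫ x, ballBump p r x ∂μ := by
  rw [← integral_indicator_one measurableSet_ball]
  refine integral_mono ((integrable_const (1 : ℝ)).indicator measurableSet_ball)
    (Integrable.of_bound (measurable_ballBump p).aestronglyMeasurable 1
      (ae_of_all _ fun x => ?_)) fun x => ?_
  · rw [Real.norm_of_nonneg (ballBump_nonneg p x)]
    exact ballBump_le_one p x
  · by_cases hx : x ∈ ball p (r / 2)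
    · rw [indicator_of_mem hx, ballBump_eq_one p hr hx]
      simp
    · rw [indicator_of_notMem hx]
      exact ballBump_nonneg p x

end BallBump

lemma measureReal_birkhoff_ballBump_le {X : Type*} [MetricSpace X] [MeasurableSpace X]
    [BorelSpace X] {T : X → X} {μ : Measure X} [IsProbabilityMeasure μ]
    (hT : MeasurePreserving T μ μ) {C θ : ℝ} (hθ : 0 < θ) (hθ1 : θ < 1)
    (hA : ∀ φ ψ : X → ℝ, IsBddLipschitz φ → IsBddLipschitz ψ → ∀ j : ℕ,
      |(∫ x, φ x * ψ (T^[j] x) ∂μ) - (∫ x, φ x ∂μ) * ∫ x, ψ x ∂μ|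
        ≤ C * θ ^ j * lipNorm φ * lipNorm ψ)
    (p : X) {r e : ℝ} (hr : 0 < r) (he : 0 < e) (her : e ≤ ∫ x, ballBump p r x ∂μ) (K : ℕ) {n : ℕ}
    (hn : 0 < n) :
    μ.real {x | ∑ j ∈ Finset.range n, ballBump p r (T^[j] x) ≤ n * e / 2} ≤
      8 * K / (n * e) + 4 * (|C| * θ ^ K * (1 + 2 / r) ^ 2) / e ^ 2 := by
  have hn' : (0 : ℝ) < n := by exact_mod_cast hn
  have h1 := measureReal_birkhoff_le_half_mean hT (measurable_ballBump p (r := r))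
    (ballBump_nonneg p) (ballBump_le_one p) (he.trans_le her)
    (B := |C| * θ ^ K * (1 + 2 / r) ^ 2) (K := K) (by positivity) (fun m hm => ?_) hn
  · refine (measureReal_mono fun x hx => ?_).trans (h1.trans ?_)
    · rw [mem_ofPred_eq] at hx ⊢
      exact hx.trans (by gcongr)
    · gcongr
  · refine (le_abs_self _).trans ((hA _ _ (isBddLipschitz_ballBump p hr)
      (isBddLipschitz_ballBump p hr) m).trans ?_)
    have h2 := lipNorm_ballBump_le p hr
    have h3 := lipNorm_nonneg (ballBump p r)
    rw [mul_assoc, sq]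
    refine mul_le_mul ?_ (mul_le_mul h2 h2 h3 (by positivity)) (by positivity) (by positivity)
    exact mul_le_mul (le_abs_self C) (pow_le_pow_of_le_one hθ.le hθ1.le hm) (by positivity)
      (abs_nonneg C)

/-- The first Borel-Cantelli lemma for real valued bounds which hold eventually. -/
lemma ae_eventually_notMem_of_measureReal_le {X : Type*} [MeasurableSpace X] {μ : Measure X}
    [IsFiniteMeasure μ] {S : ℕ → Set X} {b : ℕ → ℝ} (hb : Summable b)
    (h : ∀ᶠ i in atTop, μ.real (S i) ≤ b i) : ∀ᵐ x ∂μ, ∀ᶠ i in atTop, x ∉ S i := by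
  refine ae_eventually_notMem ?_
  have hs : Summable fun i => μ.real (S i) := by
    refine Summable.of_norm_bounded_eventually_nat hb ?_
    filter_upwards [h] with i hi
    rwa [Real.norm_of_nonneg measureReal_nonneg]
  have h1 : ∀ i, μ (S i) = ENNReal.ofReal (μ.real (S i)) := fun i => (ofReal_measureReal).symm
  simp_rw [h1]
  rw [← ENNReal.ofReal_tsum_of_nonneg (fun i => measureReal_nonneg) hs]
  exact ENNReal.ofReal_ne_top

lemma ofReal_rpow_le_poleObservable {X : Type*} [MetricSpace X] {p x : X} {r k : ℝ} (hr : 0 < r)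
    (hk : 0 ≤ k) (hx : dist x p ≤ r) : ENNReal.ofReal (r ^ (-k)) ≤ poleObservable p k x := by
  rw [poleObservable, ← ENNReal.ofReal_rpow_of_pos hr, ENNReal.rpow_neg, ENNReal.rpow_neg,
    ENNReal.inv_le_inv, edist_dist]
  exact ENNReal.rpow_le_rpow (ENNReal.ofReal_le_ofReal hx) hk

lemma birkhoffS_mono {X : Type*} (T : X → X) (φ : X → ℝ≥0∞) (x : X) :
    Monotone fun n => birkhoffS T φ n x := fun _ _ hmn =>
  Finset.sum_le_sum_of_subset (Finset.range_mono hmn)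

lemma tendsto_nat_log_two_atTop : Tendsto (fun n : ℕ => Nat.log 2 n) atTop atTop :=
  tendsto_atTop.2 fun b => by
    filter_upwards [eventually_ge_atTop (2 ^ b)] with n hn
    exact Nat.le_log_of_pow_le one_lt_two hn

/-- Orbits hit the ball of measure about `i ^ 3 / 2 ^ i` before time `2 ^ i`. -/
theorem ae_eventually_exists_iterate_mem_ball {X : Type*} [MetricSpace X] [MeasurableSpace X]
    [BorelSpace X] {T : X → X} {μ : Measure X} [IsProbabilityMeasure μ]
    (hT : MeasurePreserving T μ μ) (hA : ExpDecayLipschitz T μ) {p : X} {D : ℕ} (hD : 1 ≤ D)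
    {c r₀ : ℝ} (hc : 0 < c) (hr₀ : 0 < r₀)
    (h : ∀ r : ℝ, 0 < r → r < r₀ → ENNReal.ofReal (c * r ^ D) ≤ μ (ball p r)) :
    ∀ᵐ x ∂μ, ∀ᶠ i : ℕ in atTop, ∃ j < 2 ^ i,
      dist (T^[j] x) p < (((i : ℝ) + 1) ^ 3 / 2 ^ i) ^ (1 / (D : ℝ)) := by
  obtain ⟨C, θ, hθ, hθ1, hA⟩ := hA
  have hD0 : (0 : ℝ) < D := by exact_mod_cast hD
  set v : ℕ → ℝ := fun i => ((i : ℝ) + 1) ^ 3 / 2 ^ i with hv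
  set r : ℕ → ℝ := fun i => v i ^ (1 / (D : ℝ)) with hr
  have v_pos : ∀ i, 0 < v i := fun i => by positivity
  have r_pos : ∀ i, 0 < r i := fun i => by have := v_pos i; positivity
  have r_pow : ∀ i, r i ^ D = v i := fun i => by
    rw [hr, ← Real.rpow_natCast, ← Real.rpow_mul (v_pos i).le, one_div_mul_cancel hD0.ne',
      Real.rpow_one]
  have v_tendsto : Tendsto v atTop (𝓝 0) := by
    have h1 := ((tendsto_pow_const_div_const_pow_of_one_lt 3
      (one_lt_two (α := ℝ))).comp (tendsto_add_atTop_nat 1)).const_mul 2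
    rw [mul_zero] at h1
    refine h1.congr fun i => ?_
    simp only [Function.comp_apply, hv]
    push_cast
    rw [pow_succ 2 i]
    field_simp
  have r_tendsto : Tendsto r atTop (𝓝 0) := by
    have h1 := v_tendsto.rpow_const (p := 1 / (D : ℝ)) (Or.inr (by positivity))
    rwa [Real.zero_rpow (by positivity)] at h1
  obtain ⟨M, hM⟩ := exists_pow_lt_of_lt_one (show (0 : ℝ) < 1 / 32 by norm_num) hθ1
  set c' : ℝ := c / 2 ^ D with hc'
  have c'_pos : 0 < c' := by positivity
  have hsum : Summable fun i : ℕ => 8 * M / c' * (((i + 1 : ℕ) : ℝ) ^ 2)⁻¹ +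
      36 * |C| / c' ^ 2 * (1 / 2) ^ i :=
    (((summable_nat_add_iff 1).2 (Real.summable_nat_pow_inv.2 one_lt_two)).mul_left _).add
      ((summable_geometric_of_lt_one (by norm_num) (by norm_num)).mul_left _)
  have hBC := ae_eventually_notMem_of_measureReal_le (μ := μ) hsum
    (S := fun i => {x | ∑ j ∈ Finset.range (2 ^ i), ballBump p (r i) (T^[j] x) ≤
      (2 ^ i : ℕ) * (c' * v i) / 2}) ?_
  · filter_upwards [hBC] with x hx
    filter_upwards [hx] with i hi
    by_contra! hcon
    refine hi ?_
    rw [Finset.sum_eq_zero fun j hj =>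
      ballBump_eq_zero p (r_pos i) (hcon j (Finset.mem_range.1 hj))]
    have := v_pos i
    positivity
  · filter_upwards [r_tendsto.eventually_lt_const hr₀, r_tendsto.eventually_lt_const one_pos]
      with i hi0 hi1
    have hri := r_pos i
    have hvi := v_pos i
    have he : c' * v i ≤ ∫ x, ballBump p (r i) x ∂μ := by
      refine le_trans ?_ (measureReal_ball_le_integral_ballBump p μ hri)
      refine (ENNReal.ofReal_le_iff_le_toReal (measure_ne_top _ _)).1 (le_trans (le_of_eq ?_)
        (h (r i / 2) (by positivity) (by linarith)))
      rw [div_pow, r_pow, hc']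
      congr 1
      ring
    refine (measureReal_birkhoff_ballBump_le hT hθ hθ1 hA p hri (by positivity) he (M * i)
      (by positivity)).trans (add_le_add ?_ ?_)
    · have h1 : ((2 ^ i : ℕ) : ℝ) * (c' * v i) = c' * ((i : ℝ) + 1) ^ 3 := by
        simp only [hv]
        push_cast
        field_simp
      rw [h1]
      push_cast
      rw [← div_eq_mul_inv, div_div, div_le_div_iff₀ (by positivity) (by positivity)]
      have : (i : ℝ) ≤ i + 1 := by linarith
      calc 8 * ((M : ℝ) * i) * (c' * (i + 1) ^ 2) ≤ 8 * (M * (i + 1)) * (c' * (i + 1) ^ 2) := by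
            gcongr
        _ = _ := by ring
    · have h1 : θ ^ (M * i) ≤ (1 / 32) ^ i := by
        rw [pow_mul]
        gcongr
      have h2 : 1 + 2 / r i ≤ 3 / r i := by
        rw [← sub_nonneg]
        have : 3 / r i - (1 + 2 / r i) = (1 - r i) / r i := by field_simp; ring
        rw [this]
        exact div_nonneg (by linarith) hri.le
      have h3 : 1 / (r i ^ 2 * v i ^ 2) ≤ 16 ^ i := by
        have h4 : v i ≤ r i := by
          rw [← r_pow]
          exact pow_le_of_le_one hri.le hi1.le (by lia)
        have h5 : (1 : ℝ) / 16 ^ i ≤ v i ^ 4 := by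
          simp only [hv]
          rw [div_pow, pow_right_comm 2 i 4, show (2 : ℝ) ^ 4 = 16 by norm_num]
          gcongr
          refine one_le_pow₀ (one_le_pow₀ ?_)
          have := Nat.cast_nonneg (α := ℝ) i
          linarith
        have h6 : v i ^ 4 ≤ r i ^ 2 * v i ^ 2 := by
          rw [show v i ^ 4 = v i ^ 2 * v i ^ 2 by ring]
          gcongr
        rw [one_div_le (by positivity) (by positivity)]
        exact h5.trans h6
      calc 4 * (|C| * θ ^ (M * i) * (1 + 2 / r i) ^ 2) / (c' * v i) ^ 2
          ≤ 4 * (|C| * (1 / 32) ^ i * (3 / r i) ^ 2) / (c' * v i) ^ 2 := by gcongr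
        _ = 36 * |C| / c' ^ 2 * (1 / 32) ^ i * (1 / (r i ^ 2 * v i ^ 2)) := by
            field_simp
            ring
        _ ≤ 36 * |C| / c' ^ 2 * (1 / 32) ^ i * 16 ^ i := by gcongr
        _ = _ := by
            rw [mul_assoc, ← mul_pow]
            norm_num

lemma eventually_two_le_exp_rpow_div {a : ℝ} (ha : 0 < a) :
    ∀ᶠ y : ℝ in atTop, 2 * (2 * (2 * y + 1) ^ 3) ≤ Real.exp (y ^ a) := by
  have h1 := (tendsto_exp_div_rpow_atTop (3 / a)).comp (tendsto_rpow_atTop ha)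
  filter_upwards [h1.eventually_ge_atTop 108, eventually_ge_atTop 1] with y hy hy1
  simp only [Function.comp_apply] at hy
  rw [← Real.rpow_mul (by linarith), mul_div_cancel₀ _ ha.ne',
    le_div_iff₀ (by positivity), Real.rpow_ofNat] at hy
  refine le_trans ?_ hy
  calc 2 * (2 * (2 * y + 1) ^ 3) ≤ 2 * (2 * (2 * y + y) ^ 3) := by gcongr
    _ = 108 * y ^ 3 := by ring

/-- If `φ` has a pole of order `k ≥ D`, then the Birkhoff sums of `φ` are eventually at least
`n ^ (k / D)` up to a factor which is smaller than any power of `n`. -/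
theorem ae_one_lt_liminf_birkhoffS_div {X : Type*} [MetricSpace X] [MeasurableSpace X]
    [BorelSpace X] {T : X → X} {μ : Measure X} [IsProbabilityMeasure μ]
    (hT : MeasurePreserving T μ μ) (hA : ExpDecayLipschitz T μ) {p : X} {D : ℕ} (hD : 1 ≤ D)
    {c r₀ k a : ℝ} (hc : 0 < c) (hr₀ : 0 < r₀) (hDk : (D : ℝ) ≤ k) (ha : 0 < a)
    (h : ∀ r : ℝ, 0 < r → r < r₀ → ENNReal.ofReal (c * r ^ D) ≤ μ (ball p r)) :
    ∀ᵐ x ∂μ, 1 < liminf (fun n : ℕ => birkhoffS T (poleObservable p k) n x /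
        ENNReal.ofReal ((n : ℝ) ^ (k / D) * Real.exp (-(Real.log n ^ a)) ^ (k / D))) atTop := by
  have hD0 : (0 : ℝ) < D := by exact_mod_cast hD
  have hk : 0 < k := hD0.trans_le hDk
  have hkD : 1 ≤ k / D := (one_le_div hD0).2 hDk
  filter_upwards [ae_eventually_exists_iterate_mem_ball hT hA hD hc hr₀ h] with x hx
  refine lt_of_lt_of_le (ENNReal.one_lt_two) (le_liminf_of_le (by isBoundedDefault) ?_)
  have hlogt : Tendsto (fun n : ℕ => Real.log n) atTop atTop :=
    Real.tendsto_log_atTop.comp tendsto_natCast_atTop_atTop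
  filter_upwards [tendsto_nat_log_two_atTop.eventually hx, hlogt.eventually (eventually_two_le_exp_rpow_div ha),
    eventually_ge_atTop 2] with n hn hexp hn2
  set i := Nat.log 2 n with hi
  obtain ⟨j, hj, hjd⟩ := hn
  have hn0 : (0 : ℝ) < n := by exact_mod_cast (by lia : 0 < n)
  have hin : 2 ^ i ≤ n := Nat.pow_log_le_self 2 (by lia)
  have hni : (n : ℝ) ≤ 2 * 2 ^ i := by
    have := (Nat.lt_pow_succ_log_self one_lt_two n).le
    rw [pow_succ'] at this
    exact_mod_cast this
  have hil : (i : ℝ) ≤ 2 * Real.log n := by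
    have h1 : (i : ℝ) * Real.log 2 ≤ Real.log n := by
      rw [← Real.log_pow]
      exact Real.log_le_log (by positivity) (by exact_mod_cast hin)
    have h2 := Real.log_two_gt_d9
    have h3 := Nat.cast_nonneg (α := ℝ) i
    nlinarith
  have hv : (0 : ℝ) < ((i : ℝ) + 1) ^ 3 / 2 ^ i := by positivity
  have hS : ENNReal.ofReal ((2 ^ i / ((i : ℝ) + 1) ^ 3) ^ (k / D)) ≤
      birkhoffS T (poleObservable p k) n x := by
    refine le_trans ?_ (Finset.single_le_sum (fun _ _ => zero_le)
      (Finset.mem_range.2 (hj.trans_le hin)))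
    refine le_trans (le_of_eq ?_) (ofReal_rpow_le_poleObservable (by positivity) hk.le hjd.le)
    rw [← Real.rpow_mul hv.le, ← inv_div, Real.inv_rpow hv.le, ← Real.rpow_neg hv.le]
    congr 2
    ring
  have hden : 0 < (n : ℝ) ^ (k / D) * Real.exp (-(Real.log n ^ a)) ^ (k / D) := by positivity
  rw [ENNReal.le_div_iff_mul_le (Or.inl (ENNReal.ofReal_pos.2 hden).ne')
    (Or.inl ENNReal.ofReal_ne_top)]
  refine le_trans (le_of_eq_of_le ?_ (ENNReal.ofReal_le_ofReal (?_ :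
    2 * ((n : ℝ) ^ (k / D) * Real.exp (-(Real.log n ^ a)) ^ (k / D)) ≤ _))) hS
  · rw [ENNReal.ofReal_mul two_pos.le, ENNReal.ofReal_ofNat]
  · rw [← Real.mul_rpow (by positivity) (by positivity)]
    calc 2 * (n * Real.exp (-(Real.log n ^ a))) ^ (k / D)
        ≤ 2 ^ (k / D) * (n * Real.exp (-(Real.log n ^ a))) ^ (k / D) := by
          gcongr
          exact Real.self_le_rpow_of_one_le one_le_two hkD
      _ = (2 * (n * Real.exp (-(Real.log n ^ a)))) ^ (k / D) := by
          rw [Real.mul_rpow two_pos.le (by positivity)]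
      _ ≤ _ := by
          refine Real.rpow_le_rpow (by positivity) ?_ (by positivity)
          rw [Real.exp_neg, ← div_eq_mul_inv, ← mul_div_assoc,
            div_le_div_iff₀ (by positivity) (by positivity)]
          calc 2 * (n : ℝ) * (i + 1) ^ 3 ≤ 2 * (2 * 2 ^ i) * (2 * Real.log n + 1) ^ 3 := by
                gcongr
            _ = 2 ^ i * (2 * (2 * (2 * Real.log n + 1) ^ 3)) := by ring
            _ ≤ _ := by gcongr

/-- If `φ` has a pole of positive order, then the Birkhoff averages of `φ` are bounded below. -/
theorem exists_ae_lt_liminf_birkhoffS_div {X : Type*} [MetricSpace X] [MeasurableSpace X]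
    [BorelSpace X] {T : X → X} {μ : Measure X} [IsProbabilityMeasure μ]
    (hT : MeasurePreserving T μ μ) (hA : ExpDecayLipschitz T μ) {p : X} {r k : ℝ}
    (hr : 0 < r) (hk : 0 ≤ k) (h : 0 < μ (ball p (r / 2))) :
    ∃ a : ℝ, 0 < a ∧ ∀ᵐ x ∂μ, ENNReal.ofReal a <
      liminf (fun n : ℕ => birkhoffS T (poleObservable p k) n x / (n : ℝ≥0∞)) atTop := by
  obtain ⟨C, θ, hθ, hθ1, hA⟩ := hA
  set e := ∫ x, ballBump p r x ∂μ with he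
  have e_pos : 0 < e := (ENNReal.toReal_pos h.ne' (measure_ne_top _ _)).trans_le
    (measureReal_ball_le_integral_ballBump p μ hr)
  have hq : 0 < r ^ (-k) := by positivity
  refine ⟨r ^ (-k) * e / 8, by positivity, ?_⟩
  have hsum : Summable fun i : ℕ => 8 / e * ((i : ℝ) ^ 1 * (1 / 2) ^ i) +
      4 * |C| * (1 + 2 / r) ^ 2 / e ^ 2 * θ ^ i := by
    have h1 : ‖(1 / 2 : ℝ)‖ < 1 := by norm_num
    have h2 := summable_pow_mul_geometric_of_norm_lt_one 1 h1
    exact (h2.mul_left _).add ((summable_geometric_of_lt_one hθ.le hθ1).mul_left _)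
  have hBC := ae_eventually_notMem_of_measureReal_le (μ := μ) hsum
    (S := fun i => {x | ∑ j ∈ Finset.range (2 ^ i), ballBump p r (T^[j] x) ≤
      (2 ^ i : ℕ) * e / 2}) (Eventually.of_forall fun i => ?_)
  · filter_upwards [hBC] with x hx
    have hlt : r ^ (-k) * e / 8 < r ^ (-k) * e / 4 := by linarith [mul_pos hq e_pos]
    refine lt_of_lt_of_le ((ENNReal.ofReal_lt_ofReal_iff (by positivity)).2 hlt)
      (le_liminf_of_le (by isBoundedDefault) ?_)
    filter_upwards [tendsto_nat_log_two_atTop.eventually hx, eventually_ge_atTop 1] with n hn hn1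
    set i := Nat.log 2 n with hi
    replace hn := not_le.1 hn
    have hn0 : (0 : ℝ) < n := by exact_mod_cast hn1
    have hin : 2 ^ i ≤ n := Nat.pow_log_le_self 2 (by lia)
    have hni : (n : ℝ) ≤ 2 * (2 ^ i : ℕ) := by
      have := (Nat.lt_pow_succ_log_self one_lt_two n).le
      rw [pow_succ'] at this
      exact_mod_cast this
    rw [ENNReal.le_div_iff_mul_le (Or.inl (by exact_mod_cast hn0.ne'))
      (Or.inl (ENNReal.natCast_ne_top n))]
    refine le_trans ?_ (birkhoffS_mono T _ x hin)
    calc ENNReal.ofReal (r ^ (-k) * e / 4) * n = ENNReal.ofReal (r ^ (-k) * e / 4 * n) := by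
          rw [ENNReal.ofReal_mul (by positivity), ENNReal.ofReal_natCast]
      _ ≤ ENNReal.ofReal (∑ j ∈ Finset.range (2 ^ i), r ^ (-k) * ballBump p r (T^[j] x)) := by
          refine ENNReal.ofReal_le_ofReal ?_
          rw [← Finset.mul_sum]
          calc r ^ (-k) * e / 4 * n ≤ r ^ (-k) * e / 4 * (2 * (2 ^ i : ℕ)) := by gcongr
            _ = r ^ (-k) * ((2 ^ i : ℕ) * e / 2) := by ring
            _ ≤ _ := by gcongr
      _ = ∑ j ∈ Finset.range (2 ^ i), ENNReal.ofReal (r ^ (-k) * ballBump p r (T^[j] x)) :=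
          ENNReal.ofReal_sum_of_nonneg fun j _ => mul_nonneg hq.le (ballBump_nonneg p _)
      _ ≤ _ := by
          refine Finset.sum_le_sum fun j _ => ?_
          rcases le_total r (dist (T^[j] x) p) with hd | hd
          · rw [ballBump_eq_zero p hr hd, mul_zero, ENNReal.ofReal_zero]
            exact zero_le
          · refine le_trans (ENNReal.ofReal_le_ofReal ?_) (ofReal_rpow_le_poleObservable hr hk hd)
            exact mul_le_of_le_one_right hq.le (ballBump_le_one p _)
  · refine (measureReal_birkhoff_ballBump_le hT hθ hθ1 hA p hr e_pos le_rfl i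
      (by positivity)).trans (le_of_eq ?_)
    push_cast
    rw [one_div_pow]
    field_simp

end LowerBound

/-- `X` is a Riemannian manifold (possibly with boundary or corners) of dimension `D ≥ 1` with its
Riemannian distance, `μHE[D]` (the `D`-dimensional Hausdorff measure of that distance, normalized
to be Lebesgue measure on Euclidean space) is its Riemannian volume, and `h` is the density of the
invariant measure `μ` with respect to it. -/
theorem theorem3
    {E : Type*} [NormedAddCommGroup E] [NormedSpace ℝ E] [FiniteDimensional ℝ E]
    {H : Type*} [TopologicalSpace H] (I : ModelWithCorners ℝ E H)
    {X : Type*} [MetricSpace X] [ChartedSpace H X] [IsManifold I 1 X]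
    [RiemannianBundle (fun x : X => TangentSpace I x)]
    [IsContinuousRiemannianBundle E (fun x : X => TangentSpace I x)]
    [IsRiemannianManifold I X]
    [MeasurableSpace X] [BorelSpace X]
    (D : ℕ) (hD : Module.finrank ℝ E = D) (hD1 : 1 ≤ D)
    (T : X → X) (μ : Measure X) [IsProbabilityMeasure μ] (hT : Ergodic T μ)
    (hA : ExpDecayLipschitz T μ) (hB : ThinAnnuli μ)
    (h : X → ℝ≥0∞) (hh : Measurable h) (hμ : μ = (μHE[D] : Measure X).withDensity h)
    (p : X) (hp : DensityBoundedAt (μHE[D] : Measure X) h p) (k : ℝ) :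
    ((D : ℝ) < k → ∀ ε : ℝ, 0 < ε → ∀ᵐ x ∂μ,
      limsup (fun n : ℕ => birkhoffS T (poleObservable p k) n x /
        ENNReal.ofReal ((n : ℝ) ^ (k / D) * Real.log n ^ (k / D + ε))) atTop = 0 ∧
      1 < liminf (fun n : ℕ => birkhoffS T (poleObservable p k) n x /
        ENNReal.ofReal ((n : ℝ) ^ (k / D) *
          Real.exp (-(Real.log n ^ (1 / 2 + ε))) ^ (k / D))) atTop) ∧
    (k = D → ∃ a : ℝ, 0 < a ∧ ∀ᵐ x ∂μ,
      ENNReal.ofReal a <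
        liminf (fun n : ℕ => birkhoffS T (poleObservable p k) n x / (n : ℝ≥0∞)) atTop) := by
  have hT' := hT.toMeasurePreserving
  obtain ⟨c, c_pos, C, C_pos, r₀, r₀_pos, hball⟩ := exists_measure_ball_bounds I D hD μ h hμ p hp
  obtain ⟨C', C'_pos, hC'⟩ := exists_measure_ball_le_pow r₀_pos fun r hr hr' => (hball r hr hr').2
  refine ⟨fun hDk ε hε => ?_, fun hk => ?_⟩
  · filter_upwards [ae_tendsto_birkhoffS_div_zero hT' hD1 C'_pos hDk hC' hε,
      ae_one_lt_liminf_birkhoffS_div hT' hA hD1 c_pos r₀_pos hDk.le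
        (by positivity : 0 < 1 / 2 + ε) fun r hr hr' => (hball r hr hr').1] with x hx hx'
    exact ⟨hx.limsup_eq, hx'⟩
  · refine exists_ae_lt_liminf_birkhoffS_div hT' hA r₀_pos (by rw [hk]; positivity) ?_
    exact (ENNReal.ofReal_pos.2 (by positivity)).trans_le
      (hball (r₀ / 2) (by positivity) (by linarith)).1
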